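/- Let $p\ge 2$ be a prime number, let $q\ge 3$ be an integer coprime to $p$, put $m=pq$, and let $\ell\ge 2$ be an integer coprime to $m$. Let $X_1$ and $X_\ell$ be the closed subvarieties of $\mathbb{A}^3_{\mathbb{C}}=\operatorname{Spec}\mathbb{C}[x,y,t]$ with equations $t(x^p+y^q)=1$ and $t^\ell(x^p+y^q)=1$, respectively, and write $\mathbb{C}^*=\operatorname{Spec}\mathbb{C}[u,u^{-1}]$. Then $X_1$ and $X_\ell$ are smooth factorial affine surfaces over $\mathbb{C}$ (smooth integral affine surfaces whose coordinate rings are unique factorization domains), and their $\mathbb{C}^*$-cylinders $X_1\times\mathbb{C}^*$ and $X_\ell\times\mathbb{C}^*$ are isomorphic as complex algebraic varieties. If moreover $\ell\not\equiv 1$ and $\ell\not\equiv -1 \pmod m$, then $X_1$ and $X_\ell$ are not isomorphic as complex algebraic varieties. -/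

import Mathlib

open CategoryTheory CategoryTheory.Limits AlgebraicGeometry

noncomputable section

/-- The spectrum of a commutative `ℂ`-algebra, as a scheme over `Spec ℂ`. Morphisms in
`Over (Spec ℂ)` are morphisms of `ℂ`-schemes. -/
def SpecC (A : Type) [CommRing A] [Algebra ℂ A] : Over (Spec (CommRingCat.of ℂ)) :=
  Over.mk (Spec.map (CommRingCat.ofHom (algebraMap ℂ A)))

/-- The polynomial `t ^ ℓ * (x ^ p + y ^ q) - 1` in `ℂ[x, y, t]`, where `x, y, t` are the
variables with index `0, 1, 2`. -/
def surfacePoly (p q ℓ : ℕ) : MvPolynomial (Fin 3) ℂ :=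
  MvPolynomial.X 2 ^ ℓ * (MvPolynomial.X 0 ^ p + MvPolynomial.X 1 ^ q) - 1

/-- The closed subvariety `t ^ ℓ * (x ^ p + y ^ q) = 1` of the affine space `𝔸³` over `ℂ`. -/
def surface (p q ℓ : ℕ) : Over (Spec (CommRingCat.of ℂ)) :=
  SpecC (MvPolynomial (Fin 3) ℂ ⧸ Ideal.span {surfacePoly p q ℓ})

/-- The punctured affine line `ℂ^* = Spec ℂ[T, T⁻¹]` over `ℂ`. -/
def puncturedLine : Over (Spec (CommRingCat.of ℂ)) :=
  SpecC (LaurentPolynomial ℂ)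

/-- The `ℂ^*`-cylinder `X × ℂ^*`: the fibre product over `Spec ℂ`. -/
def cylinder (X : Over (Spec (CommRingCat.of ℂ))) : Over (Spec (CommRingCat.of ℂ)) :=
  Over.mk (pullback.fst X.hom puncturedLine.hom ≫ X.hom)

/-- A smooth factorial affine surface over `ℂ`: an integral affine scheme, smooth of relative
dimension two over `ℂ`, whose ring of regular functions is a unique factorization domain. -/
structure IsSmoothFactorialAffineSurface (X : Over (Spec (CommRingCat.of ℂ))) : Prop where
  isAffine : IsAffine X.left
  isIntegral : IsIntegral X.left
  smooth : SmoothOfRelativeDimension 2 X.hom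
  factorial : UniqueFactorizationMonoid Γ(X.left, ⊤)

end

/-!
Let `A_ℓ = ℂ[x, y, t] / (t ^ ℓ * (x ^ p + y ^ q) - 1)` be the coordinate ring of `X_ℓ`, write `s`
for the unit `1 / t`, so that `x ^ p + y ^ q = s ^ ℓ`, and put `m = p * q`.

*Cylinders.* The torus `ℂ^*` acts on both surfaces through the weights of `x` and `y`, and `X_ℓ`
is the product of `ℂ^*` and the curve `x ^ p + y ^ q = 1`, twisted by the action of the `m`-th
roots of unity through the `ℓ`-th power. As `ℓ` is prime to `m`, there are `a` and `c` with
`ℓ * c = 1 + m * a`, and the twist is absorbed by an automorphism of the torus `ℂ^* × ℂ^*`; this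
gives explicit monomial formulas for mutually inverse isomorphisms of the cylinders
(`IsCylinderRing.nonempty_algEquiv`).

*Smooth and factorial.* The derivative of `t ^ ℓ * (x ^ p + y ^ q) - 1` in `t` is a unit on `X_ℓ`,
which is the Jacobian criterion. `A_1` is a localization of `ℂ[x, y]`, hence factorial, and so is
`A_1[u, u⁻¹]`. By the isomorphism of cylinders `A_ℓ[u, u⁻¹]` is factorial; then so is `A_ℓ[u]` by
Nagata's criterion, as `u` is prime, and then `A_ℓ`, as the factors of a constant polynomial are
constant.

*Non-isomorphism.* Over `ℂ[s, s⁻¹]` the surface is an affine plane curve with one place at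
infinity, where `x` and `y` have poles of the coprime orders `q` and `p` (`exists_valuation`). The
monomials `x ^ i * y ^ j` with `i < p` span `A_ℓ` over `ℂ[s, s⁻¹]` and have distinct pole orders
(`valuation_evalPair`). Hence functions without poles, among them all units, come from
`ℂ[s, s⁻¹]`, and an isomorphism of `A_ℓ` with `A_1` sends `s` to `c * s ^ k` with `k = ±1` and
sends `x` and `y` to a generating pair `(X, Y)` with `X ^ p + Y ^ q = (c * s ^ k) ^ ℓ`. The pole
orders of `X` and `Y` are then again `q` and `p` (`valuation_of_generating`), so for `p < q` one
has `X = α * x + g(y)` and `Y = β * y + γ`, and comparing coefficients (`exists_pow_mul_eq`)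
yields `(c * s ^ k) ^ ℓ = α ^ p * s = β ^ q * s` in `ℂ[s, s⁻¹]`. So `p` and `q` both divide
`k * ℓ - 1`, that is, `ℓ ≡ ±1` modulo `m`.
-/

open scoped TensorProduct LaurentPolynomial

/-! ### The coordinate rings -/

/-- The coordinate ring `ℂ[x, y, t] / (t ^ ℓ * (x ^ p + y ^ q) - 1)` of the surface. -/
abbrev SurfaceRing (p q ℓ : ℕ) : Type :=
  MvPolynomial (Fin 3) ℂ ⧸ Ideal.span {surfacePoly p q ℓ}

namespace SurfaceRing

variable {p q ℓ : ℕ}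

/-- The coordinate function `x`. -/
noncomputable def x : SurfaceRing p q ℓ := Ideal.Quotient.mk _ (MvPolynomial.X 0)

/-- The coordinate function `y`. -/
noncomputable def y : SurfaceRing p q ℓ := Ideal.Quotient.mk _ (MvPolynomial.X 1)

/-- The coordinate function `t`. -/
noncomputable def t : SurfaceRing p q ℓ := Ideal.Quotient.mk _ (MvPolynomial.X 2)

lemma relation : (t : SurfaceRing p q ℓ) ^ ℓ * (x ^ p + y ^ q) = 1 := by
  have h : Ideal.Quotient.mk (Ideal.span {surfacePoly p q ℓ}) (surfacePoly p q ℓ) = 0 :=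
    Ideal.Quotient.eq_zero_iff_mem.2 (Ideal.subset_span rfl)
  rw [← sub_eq_zero, ← h]
  rfl

/-- The algebra homomorphism out of the coordinate ring given by a point of the surface. -/
noncomputable def lift {C : Type*} [CommRing C] [Algebra ℂ C] (a b c : C)
    (h : c ^ ℓ * (a ^ p + b ^ q) = 1) : SurfaceRing p q ℓ →ₐ[ℂ] C :=
  Ideal.Quotient.liftₐ _ (MvPolynomial.aeval ![a, b, c]) <| by
    intro z hz
    obtain ⟨w, rfl⟩ := Ideal.mem_span_singleton'.1 hz
    simp [surfacePoly, h]

section lift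

variable {C : Type*} [CommRing C] [Algebra ℂ C] (a b c : C) (h : c ^ ℓ * (a ^ p + b ^ q) = 1)

@[simp] lemma lift_x : lift a b c h x = a :=
  MvPolynomial.aeval_X ![a, b, c] 0

@[simp] lemma lift_y : lift a b c h y = b :=
  MvPolynomial.aeval_X ![a, b, c] 1

@[simp] lemma lift_t : lift a b c h t = c :=
  MvPolynomial.aeval_X ![a, b, c] 2

end lift

@[ext] lemma algHom_ext {C : Type*} [CommRing C] [Algebra ℂ C] {f g : SurfaceRing p q ℓ →ₐ[ℂ] C}
    (hx : f x = g x) (hy : f y = g y) (ht : f t = g t) : f = g := by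
  apply Ideal.Quotient.algHom_ext
  apply MvPolynomial.algHom_ext
  intro i
  fin_cases i
  exacts [hx, hy, ht]

/-- For `ℓ ≠ 0`, the function `t` as a unit of the coordinate ring. -/
noncomputable def tUnit (hℓ : ℓ ≠ 0) : (SurfaceRing p q ℓ)ˣ :=
  Units.mkOfMulEqOne t (t ^ (ℓ - 1) * (x ^ p + y ^ q)) <| by
    rw [← mul_assoc, mul_pow_sub_one hℓ, relation]

@[simp] lemma coe_tUnit (hℓ : ℓ ≠ 0) :
    ((tUnit hℓ : (SurfaceRing p q ℓ)ˣ) : SurfaceRing p q ℓ) = t :=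
  rfl

/-- Exchanging `x` and `y` identifies the coordinate rings for `(p, q)` and `(q, p)`. -/
noncomputable def swap (p q ℓ : ℕ) : SurfaceRing p q ℓ ≃ₐ[ℂ] SurfaceRing q p ℓ :=
  AlgEquiv.ofAlgHom (lift y x t (by rw [add_comm, relation]))
    (lift y x t (by rw [add_comm, relation])) (by ext <;> simp) (by ext <;> simp)

end SurfaceRing

namespace LaurentPolynomial

variable {A C : Type*} [CommRing A] [Algebra ℂ A] [CommRing C] [Algebra ℂ C]

/-- The algebra homomorphism `A[T;T⁻¹] → C` which is a given one on `A` and sends `T` to a given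
unit. -/
noncomputable def liftUnit (f : A →ₐ[ℂ] C) (u : Cˣ) : A[T;T⁻¹] →ₐ[ℂ] C :=
  { eval₂ (f : A →+* C) u with
    commutes' := fun r => (eval₂_C (f : A →+* C) u (algebraMap ℂ A r)).trans (f.commutes r) }

@[simp] lemma liftUnit_T (f : A →ₐ[ℂ] C) (u : Cˣ) (n : ℤ) :
    liftUnit f u (T n) = ((u ^ n : Cˣ) : C) :=
  eval₂_T (f : A →+* C) u n

@[simp] lemma liftUnit_C (f : A →ₐ[ℂ] C) (u : Cˣ) (r : A) :
    liftUnit f u (LaurentPolynomial.C r) = f r :=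
  eval₂_C (f : A →+* C) u r

lemma algHom_ext_T {f g : A[T;T⁻¹] →ₐ[ℂ] C} (h : ∀ a, f (.C a) = g (.C a))
    (hT : f (T 1) = g (T 1)) : f = g := by
  apply AlgHom.coe_ringHom_injective
  apply IsLocalization.ringHom_ext (Submonoid.powers (Polynomial.X : Polynomial A))
  apply Polynomial.ringHom_ext
  · intro a
    simpa [algebraMap_eq_toLaurent] using h a
  · simpa [algebraMap_eq_toLaurent] using hT

end LaurentPolynomial

/-! ### The isomorphism of the cylinders -/

/-- The torus action: multiplying `x`, `y` by `w ^ q`, `w ^ p` multiplies `x ^ p + y ^ q`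
by `w ^ (p * q)`. -/
lemma relation_torus {C : Type*} [CommRing C] {p q : ℕ} {a b : C} {σ σ' w : Cˣ}
    (h : (σ : C) * (a ^ p + b ^ q) = 1) (hw : σ' * w ^ (p * q) = σ) :
    (σ' : C) * ((a * ((w ^ q : Cˣ) : C)) ^ p + (b * ((w ^ p : Cˣ) : C)) ^ q) = 1 := by
  rw [← h, ← hw]
  push_cast
  ring

lemma mul_zpow_mul_mul_zpow {G : Type*} [CommGroup G] (g h : G) (i j k i' j' k' : ℤ) :
    (g ^ i * h ^ j) ^ k * (g ^ i' * h ^ j') ^ k' =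
      g ^ (i * k + i' * k') * h ^ (j * k + j' * k') := by
  rw [mul_zpow, mul_zpow, ← zpow_mul, ← zpow_mul, ← zpow_mul, ← zpow_mul, mul_mul_mul_comm,
    ← zpow_add, ← zpow_add]

/-- The universal property of the coordinate ring of the `ℂ^*`-cylinder over the surface
`t ^ ℓ * (x ^ p + y ^ q) = 1`, with coordinates `X`, `Y`, `τ` and `υ`. -/
structure IsCylinderRing (p q ℓ : ℕ) {B : Type} [CommRing B] [Algebra ℂ B] (X Y : B)
    (τ υ : Bˣ) : Prop where
  relation : ((τ ^ ℓ : Bˣ) : B) * (X ^ p + Y ^ q) = 1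
  exists_lift {C : Type} [CommRing C] [Algebra ℂ C] (a b : C) (σ ω : Cˣ)
    (h : ((σ ^ ℓ : Cˣ) : C) * (a ^ p + b ^ q) = 1) :
    ∃ f : B →ₐ[ℂ] C, f X = a ∧ f Y = b ∧ Units.map (f : B →* C) τ = σ ∧
      Units.map (f : B →* C) υ = ω
  hom_ext {C : Type} [CommRing C] [Algebra ℂ C] {f g : B →ₐ[ℂ] C} (hX : f X = g X)
    (hY : f Y = g Y) (hτ : Units.map (f : B →* C) τ = Units.map (g : B →* C) τ)
    (hυ : Units.map (f : B →* C) υ = Units.map (g : B →* C) υ) : f = g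

/-- The cylinders over the two surfaces are isomorphic: the two surfaces are the twisted products
of `ℂ^*` with the curve `x ^ p + y ^ q = 1` over the group of `p * q`-th roots of unity, for two
generators of its group of characters; after taking the product with `ℂ^*` the two
characters are exchanged by an automorphism of the torus `ℂ^* × ℂ^*`, with matrix of
determinant `ℓ * c - p * q * a = 1`. -/
theorem IsCylinderRing.nonempty_algEquiv {p q ℓ a c : ℕ} (hac : ℓ * c = 1 + p * q * a)
    {B B' : Type} [CommRing B] [Algebra ℂ B] [CommRing B'] [Algebra ℂ B']
    {X Y : B} {τ υ : Bˣ} (h : IsCylinderRing p q ℓ X Y τ υ)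
    {X' Y' : B'} {τ' υ' : B'ˣ} (h' : IsCylinderRing p q 1 X' Y' τ' υ') :
    Nonempty (B ≃ₐ[ℂ] B') := by
  have hac' : (ℓ * c : ℤ) = 1 + p * q * a := mod_cast hac
  obtain ⟨f, fX, fY, fτ, fυ⟩ := h.exists_lift (X' * ↑((τ' ^ (-a : ℤ) * υ' ^ (ℓ : ℤ)) ^ q))
    (Y' * ↑((τ' ^ (-a : ℤ) * υ' ^ (ℓ : ℤ)) ^ p)) (τ' ^ (c : ℤ) * υ' ^ (-(p * q : ℕ) : ℤ))
    (τ' ^ (-a : ℤ) * υ' ^ (ℓ : ℤ)) <| by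
      refine relation_torus h'.relation ?_
      rw [← zpow_natCast _ ℓ, ← zpow_natCast _ (p * q), mul_zpow_mul_mul_zpow]
      rw [show (c * ℓ + -a * (p * q : ℕ) : ℤ) = 1 by push_cast; linarith,
        show (-(p * q : ℕ) * ℓ + ℓ * (p * q : ℕ) : ℤ) = 0 by ring, zpow_one, zpow_zero, mul_one,
        pow_one]
  obtain ⟨g, gX, gY, gτ, gυ⟩ := h'.exists_lift (X * ↑((υ⁻¹) ^ q)) (Y * ↑((υ⁻¹) ^ p))
    (τ ^ (ℓ : ℤ) * υ ^ ((p * q : ℕ) : ℤ)) (τ ^ (a : ℤ) * υ ^ (c : ℤ)) <| by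
      refine relation_torus h.relation ?_
      rw [inv_pow, zpow_natCast, zpow_natCast, pow_one, mul_inv_cancel_right]
  have unit_map {C D : Type} [CommRing C] [CommRing D] [Algebra ℂ C] [Algebra ℂ D]
      (f : C →ₐ[ℂ] D) (u : Cˣ) : f u = ((Units.map (f : C →* D) u : Dˣ) : D) := rfl
  have unit_comp {C D E : Type} [CommRing C] [CommRing D] [CommRing E] [Algebra ℂ C] [Algebra ℂ D]
      [Algebra ℂ E] (f : C →ₐ[ℂ] D) (g : D →ₐ[ℂ] E) (u : Cˣ) :
      Units.map (g.comp f : C →* E) u = Units.map (g : D →* E) (Units.map (f : C →* D) u) := rfl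
  have unit_id {C : Type} [CommRing C] [Algebra ℂ C] (u : Cˣ) :
      Units.map (AlgHom.id ℂ C : C →* C) u = u := rfl
  -- the inverse automorphism of the torus recovers the coordinate `υ`, hence `X` and `Y`
  have key : (τ ^ (ℓ : ℤ) * υ ^ ((p * q : ℕ) : ℤ)) ^ (-a : ℤ) *
      (τ ^ (a : ℤ) * υ ^ (c : ℤ)) ^ (ℓ : ℤ) = υ := by
    rw [mul_zpow_mul_mul_zpow, show (ℓ * -a + a * ℓ : ℤ) = 0 by ring,
      show ((p * q : ℕ) * -a + c * ℓ : ℤ) = 1 by push_cast; linarith]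
    simp
  refine ⟨AlgEquiv.ofAlgHom f g (h'.hom_ext ?_ ?_ ?_ ?_) (h.hom_ext ?_ ?_ ?_ ?_)⟩
  · rw [AlgHom.comp_apply, gX, map_mul, fX, unit_map, map_pow, map_inv, fυ, mul_assoc,
      ← Units.val_mul, ← mul_pow, mul_inv_cancel]
    simp
  · rw [AlgHom.comp_apply, gY, map_mul, fY, unit_map, map_pow, map_inv, fυ, mul_assoc,
      ← Units.val_mul, ← mul_pow, mul_inv_cancel]
    simp
  · rw [unit_comp, unit_id, gτ, map_mul, map_zpow, map_zpow, fτ, fυ, mul_zpow_mul_mul_zpow,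
      show (c * ℓ + -a * (p * q : ℕ) : ℤ) = 1 by push_cast; linarith,
      show (-(p * q : ℕ) * ℓ + ℓ * (p * q : ℕ) : ℤ) = 0 by ring]
    simp
  · rw [unit_comp, unit_id, gυ, map_mul, map_zpow, map_zpow, fτ, fυ, mul_zpow_mul_mul_zpow,
      show (c * a + -a * c : ℤ) = 0 by ring,
      show (-(p * q : ℕ) * a + ℓ * c : ℤ) = 1 by push_cast; linarith]
    simp
  · rw [AlgHom.comp_apply, fX, map_mul, gX, unit_map, map_pow, map_mul, map_zpow, map_zpow, gτ,
      gυ, key, mul_assoc, ← Units.val_mul, ← mul_pow, inv_mul_cancel]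
    simp
  · rw [AlgHom.comp_apply, fY, map_mul, gY, unit_map, map_pow, map_mul, map_zpow, map_zpow, gτ,
      gυ, key, mul_assoc, ← Units.val_mul, ← mul_pow, inv_mul_cancel]
    simp
  · rw [unit_comp, unit_id, fτ, map_mul, map_zpow, map_zpow, gτ, gυ, mul_zpow_mul_mul_zpow,
      show (ℓ * c + a * -(p * q : ℕ) : ℤ) = 1 by push_cast; linarith,
      show ((p * q : ℕ) * c + c * -(p * q : ℕ) : ℤ) = 0 by ring]
    simp
  · rw [unit_comp, unit_id, fυ, map_mul, map_zpow, map_zpow, gτ, gυ, key]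

namespace SurfaceRing

variable {p q ℓ : ℕ}

/-- The Laurent polynomial ring over the coordinate ring of the surface is the coordinate ring
of the cylinder. -/
theorem exists_isCylinderRing (hℓ : ℓ ≠ 0) :
    ∃ (X Y : (SurfaceRing p q ℓ)[T;T⁻¹]) (τ υ : ((SurfaceRing p q ℓ)[T;T⁻¹])ˣ),
      IsCylinderRing p q ℓ X Y τ υ := by
  obtain ⟨υ, hυ⟩ := LaurentPolynomial.isUnit_T (R := SurfaceRing p q ℓ) 1
  obtain ⟨τ, hτ⟩ := (tUnit (p := p) (q := q) hℓ).isUnit.map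
    (LaurentPolynomial.C (R := SurfaceRing p q ℓ))
  refine ⟨.C x, .C y, τ, υ, ?_, ?_, ?_⟩
  · rw [Units.val_pow_eq_pow_val, hτ, coe_tUnit, ← map_pow, ← map_pow, ← map_pow, ← map_add,
      ← map_mul, relation, map_one]
  · intro C _ _ a b σ ω h
    refine ⟨LaurentPolynomial.liftUnit (lift a b σ (by simpa using h)) ω, ?_, ?_, ?_, ?_⟩
    · simp
    · simp
    · ext
      simp [hτ]
    · ext
      simp [hυ]
  · intro C _ _ f g hX hY h₁ h₂
    replace h₁ := congrArg Units.val h₁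
    replace h₂ := congrArg Units.val h₂
    simp only [Units.coe_map, hτ, hυ] at h₁ h₂
    refine LaurentPolynomial.algHom_ext_T ?_ h₂
    have : f.comp (IsScalarTower.toAlgHom ℂ (SurfaceRing p q ℓ) _) =
        g.comp (IsScalarTower.toAlgHom ℂ (SurfaceRing p q ℓ) _) :=
      algHom_ext hX hY h₁
    exact fun a => DFunLike.congr_fun this a

theorem nonempty_cylinder_algEquiv (hℓ : 2 ≤ ℓ) (hm : 1 < p * q) (h : ℓ.Coprime (p * q)) :
    Nonempty ((SurfaceRing p q ℓ)[T;T⁻¹] ≃ₐ[ℂ] (SurfaceRing p q 1)[T;T⁻¹]) := by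
  obtain ⟨X, Y, τ, υ, hc⟩ := exists_isCylinderRing (p := p) (q := q) (ℓ := ℓ) (by lia)
  obtain ⟨X', Y', τ', υ', hc'⟩ := exists_isCylinderRing (p := p) (q := q) one_ne_zero
  obtain ⟨c, -, hc₁⟩ := Nat.exists_mul_mod_eq_one_of_coprime h hm
  refine IsCylinderRing.nonempty_algEquiv (a := ℓ * c / (p * q)) (c := c) ?_ hc hc'
  rw [show 1 + p * q * (ℓ * c / (p * q)) = ℓ * c % (p * q) + p * q * (ℓ * c / (p * q)) by rw [hc₁],
    Nat.mod_add_div]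

/-! ### Smoothness -/

lemma isUnit_t (hℓ : ℓ ≠ 0) : IsUnit (t : SurfaceRing p q ℓ) := (tUnit hℓ).isUnit

/-- The Jacobian criterion: `∂/∂t (t ^ ℓ * (x ^ p + y ^ q) - 1)` is invertible on the surface. -/
theorem isStandardSmoothOfRelativeDimension (hℓ : ℓ ≠ 0) :
    Algebra.IsStandardSmoothOfRelativeDimension 2 ℂ (SurfaceRing p q ℓ) := by
  let v : Unit → MvPolynomial (Fin 3) ℂ := fun _ => surfacePoly p q ℓ
  have hv : Set.range v = {surfacePoly p q ℓ} := Set.range_const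
  let e : (MvPolynomial (Fin 3) ℂ ⧸ Ideal.span (Set.range v)) ≃ₐ[ℂ] SurfaceRing p q ℓ :=
    Ideal.quotientEquivAlgOfEq ℂ (congrArg Ideal.span hv)
  let P := Algebra.PreSubmersivePresentation.naive (R := ℂ) (v := v) (fun _ => (2 : Fin 3))
    (fun _ _ _ => rfl)
  have hP : IsUnit P.jacobian := by
    have hd : MvPolynomial.pderiv 2 (surfacePoly p q ℓ) =
        (ℓ : MvPolynomial (Fin 3) ℂ) * MvPolynomial.X 2 ^ (ℓ - 1) *
          (MvPolynomial.X 0 ^ p + MvPolynomial.X 1 ^ q) := by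
      simp [surfacePoly, Derivation.leibniz_pow]
      ring
    have hm : P.jacobiMatrix default default = MvPolynomial.pderiv 2 (surfacePoly p q ℓ) :=
      Algebra.PreSubmersivePresentation.jacobiMatrix_naive ..
    have he : (e : _ →ₐ[ℂ] SurfaceRing p q ℓ).comp (MvPolynomial.aeval P.val) =
        MvPolynomial.aeval ![x, y, t] := by
      apply MvPolynomial.algHom_ext
      intro i
      rw [AlgHom.comp_apply, MvPolynomial.aeval_X, MvPolynomial.aeval_X]
      fin_cases i <;> rfl
    have hJ : e P.jacobian = (ℓ : SurfaceRing p q ℓ) * t ^ (ℓ - 1) * (x ^ p + y ^ q) := by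
      rw [P.jacobian_eq_jacobiMatrix_det, Matrix.det_unique, hm, P.algebraMap_apply]
      refine (DFunLike.congr_fun he _).trans ?_
      simp [hd]
    have hℓ' : IsUnit (ℓ : SurfaceRing p q ℓ) := by
      simpa using (Nat.cast_ne_zero.2 hℓ : (ℓ : ℂ) ≠ 0).isUnit.map
        (algebraMap ℂ (SurfaceRing p q ℓ))
    rw [← MulEquiv.isUnit_map e, hJ]
    exact (hℓ'.mul ((isUnit_t hℓ).pow _)).mul (IsUnit.of_mul_eq_one_right _ relation)
  let S : Algebra.SubmersivePresentation ℂ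
      (MvPolynomial (Fin 3) ℂ ⧸ Ideal.span (Set.range v)) (Fin 3) Unit :=
    { P with jacobian_isUnit := hP }
  have := S.isStandardSmoothOfRelativeDimension (n := 2) (by simp [Algebra.Presentation.dimension])
  exact .of_algEquiv 2 e

/-! ### Factoriality -/

/-- For `ℓ = 1`, the coordinate ring is the localization of `ℂ[x, y]` away from `x ^ p + y ^ q`. -/
theorem nonempty_ringEquiv_localization : Nonempty (SurfaceRing p q 1 ≃+* Localization.Away
    (MvPolynomial.X 0 ^ p + MvPolynomial.X 1 ^ q : MvPolynomial (Fin 2) ℂ)) := by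
  set f : MvPolynomial (Fin 2) ℂ := MvPolynomial.X 0 ^ p + MvPolynomial.X 1 ^ q with hf
  let ι := algebraMap (MvPolynomial (Fin 2) ℂ) (Localization.Away f)
  have hι : IsLocalization.Away.invSelf f * (ι (.X 0) ^ p + ι (.X 1) ^ q) = 1 := by
    rw [← map_pow, ← map_pow, ← map_add, ← hf, mul_comm]
    exact IsLocalization.Away.mul_invSelf f
  let g : SurfaceRing p q 1 →ₐ[ℂ] Localization.Away f :=
    lift (ι (.X 0)) (ι (.X 1)) (IsLocalization.Away.invSelf f) (by rw [pow_one, hι])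
  let α : MvPolynomial (Fin 2) ℂ →ₐ[ℂ] SurfaceRing p q 1 := MvPolynomial.aeval ![x, y]
  have hα : t * α f = 1 := by simpa [α, hf] using relation (p := p) (q := q) (ℓ := 1)
  let h : Localization.Away f →+* SurfaceRing p q 1 :=
    IsLocalization.Away.lift (g := (α : _ →+* SurfaceRing p q 1)) f
      (IsUnit.of_mul_eq_one_right _ hα)
  have hh (a) : h (ι a) = α a := IsLocalization.Away.lift_eq ..
  have hC (a : ℂ) : h (algebraMap ℂ _ a) = algebraMap ℂ _ a := by
    rw [IsScalarTower.algebraMap_apply ℂ (MvPolynomial (Fin 2) ℂ) (Localization.Away f)]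
    exact (hh _).trans (α.commutes a)
  let h' : Localization.Away f →ₐ[ℂ] SurfaceRing p q 1 := { h with commutes' := hC }
  have hh' (a) : h' (ι a) = α a := hh a
  refine ⟨(AlgEquiv.ofAlgHom g h' ?_ ?_).toRingEquiv⟩
  · apply AlgHom.coe_ringHom_injective
    apply IsLocalization.ringHom_ext (Submonoid.powers f)
    have : (g.comp α) = IsScalarTower.toAlgHom ℂ _ _ := by
      apply MvPolynomial.algHom_ext
      intro i
      fin_cases i <;> simp [α, g, ι]
    refine RingHom.ext fun a => ?_
    change g (h' (ι a)) = ι a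
    rw [hh']
    exact DFunLike.congr_fun this a
  · have hx : h' (g x) = x := by simp [g, hh', α]
    have hy : h' (g y) = y := by simp [g, hh', α]
    refine algHom_ext hx hy ?_
    have ht : h' (g t) * α f = 1 := by
      rw [← hh', ← map_mul, ← map_one h', ← hι]
      simp [g, hf]
    exact (IsUnit.of_mul_eq_one_right _ hα).mul_right_cancel (ht.trans hα.symm)

theorem _root_.MvPolynomial.X_pow_add_X_pow_ne_zero :
    (MvPolynomial.X 0 ^ p + MvPolynomial.X 1 ^ q : MvPolynomial (Fin 2) ℂ) ≠ 0 := by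
  intro h
  have := congrArg (MvPolynomial.eval 1) h
  norm_num at this

lemma isDomain_and_uniqueFactorizationMonoid_one :
    IsDomain (SurfaceRing p q 1) ∧ UniqueFactorizationMonoid (SurfaceRing p q 1) := by
  obtain ⟨e⟩ := nonempty_ringEquiv_localization (p := p) (q := q)
  have := IsLocalization.Away.isDomain (Localization.Away
    (MvPolynomial.X 0 ^ p + MvPolynomial.X 1 ^ q : MvPolynomial (Fin 2) ℂ))
      (MvPolynomial.X_pow_add_X_pow_ne_zero (p := p) (q := q))
  exact ⟨e.toMulEquiv.isDomain _, e.symm.toMulEquiv.uniqueFactorizationMonoid inferInstance⟩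

end SurfaceRing

/-- A noetherian domain is factorial if its polynomial ring is. -/
lemma UniqueFactorizationMonoid.of_polynomial {A : Type*} [CommRing A] [IsDomain A]
    [IsNoetherianRing A] [UniqueFactorizationMonoid (Polynomial A)] :
    UniqueFactorizationMonoid A := by
  refine ⟨fun {a} => ⟨fun h => ?_, fun h => h.irreducible⟩⟩
  rw [← Polynomial.prime_C_iff, ← UniqueFactorizationMonoid.irreducible_iff_prime]
  refine ⟨fun hu => h.not_isUnit (Polynomial.isUnit_C.1 hu), fun r s hrs => ?_⟩
  have hr : r * s ≠ 0 := by rw [← hrs]; simpa using h.ne_zero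
  have hdeg := Polynomial.natDegree_mul (left_ne_zero_of_mul hr) (right_ne_zero_of_mul hr)
  rw [← hrs, Polynomial.natDegree_C] at hdeg
  rw [Polynomial.eq_C_of_natDegree_eq_zero (p := r) (by lia),
    Polynomial.eq_C_of_natDegree_eq_zero (p := s) (by lia)] at hrs ⊢
  rw [← map_mul] at hrs
  simpa using h.isUnit_or_isUnit (Polynomial.C_injective hrs)

lemma LaurentPolynomial.C_injective {A : Type*} [Semiring A] :
    Function.Injective (LaurentPolynomial.C : A →+* A[T;T⁻¹]) :=
  fun a b hab => by simpa using congrArg (fun f => f.coeff 0) hab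

/-- A noetherian domain is factorial if its Laurent polynomial ring is. -/
lemma UniqueFactorizationMonoid.of_laurentPolynomial {A : Type*} [CommRing A] [IsDomain A]
    [IsNoetherianRing A] [UniqueFactorizationMonoid A[T;T⁻¹]] :
    UniqueFactorizationMonoid A :=
  have := (UniqueFactorizationMonoid.iff_of_isLocalizationAway_of_prime
    (Polynomial.prime_X (R := A)) A[T;T⁻¹]).2 inferInstance
  .of_polynomial

namespace SurfaceRing

variable {p q ℓ : ℕ}

/-- Factoriality descends along the cylinder, which does not depend on `ℓ`. -/
theorem isDomain_and_uniqueFactorizationMonoid (hℓ : 2 ≤ ℓ) (hm : 1 < p * q)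
    (h : ℓ.Coprime (p * q)) :
    IsDomain (SurfaceRing p q ℓ) ∧ UniqueFactorizationMonoid (SurfaceRing p q ℓ) := by
  obtain ⟨e⟩ := nonempty_cylinder_algEquiv hℓ hm h
  obtain ⟨h₁, h₂⟩ := isDomain_and_uniqueFactorizationMonoid_one (p := p) (q := q)
  have h₃ : IsDomain (SurfaceRing p q 1)[T;T⁻¹] := inferInstance
  have h₄ : UniqueFactorizationMonoid (SurfaceRing p q 1)[T;T⁻¹] :=
    .of_isLocalization (Submonoid.powers (Polynomial.X : Polynomial (SurfaceRing p q 1))) _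
  have h₅ : IsDomain (SurfaceRing p q ℓ)[T;T⁻¹] := e.toMulEquiv.isDomain _
  have h₆ : UniqueFactorizationMonoid (SurfaceRing p q ℓ)[T;T⁻¹] :=
    e.symm.toMulEquiv.uniqueFactorizationMonoid h₄
  have h₇ : IsDomain (SurfaceRing p q ℓ) :=
    Function.Injective.isDomain _ LaurentPolynomial.C_injective
  exact ⟨h₇, .of_laurentPolynomial⟩

end SurfaceRing

/-! ### Passage to schemes -/

/-- Isomorphic algebras have isomorphic spectra. -/
noncomputable def SpecC.isoOfAlgEquiv {A B : Type} [CommRing A] [Algebra ℂ A] [CommRing B]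
    [Algebra ℂ B] (e : A ≃ₐ[ℂ] B) : SpecC A ≅ SpecC B :=
  (algSpec (CommRingCat.of ℂ)).mapIso (CommAlgCat.isoMk e.symm).op

lemma nonempty_algEquiv_of_specC_iso {A B : Type} [CommRing A] [Algebra ℂ A] [CommRing B]
    [Algebra ℂ B] (e : SpecC A ≅ SpecC B) : Nonempty (A ≃ₐ[ℂ] B) := by
  let e' : (algSpec (CommRingCat.of ℂ)).obj (Opposite.op (CommAlgCat.of ℂ A)) ≅
      (algSpec (CommRingCat.of ℂ)).obj (Opposite.op (CommAlgCat.of ℂ B)) := e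
  have := (algSpec.fullyFaithful.preimageIso e').unop
  exact ⟨(CommAlgCat.algEquivOfIso this).symm⟩

/-- The cylinder over the spectrum of `A` is the spectrum of the Laurent polynomial ring. -/
noncomputable def SpecC.cylinderIso (A : Type) [CommRing A] [Algebra ℂ A] :
    cylinder (SpecC A) ≅ SpecC A[T;T⁻¹] :=
  let e : cylinder (SpecC A) ≅ SpecC (A ⊗[ℂ] ℂ[T;T⁻¹]) :=
    Over.isoMk (pullbackSpecIso ℂ A ℂ[T;T⁻¹]) <| by
      have h : algebraMap ℂ (A ⊗[ℂ] ℂ[T;T⁻¹]) =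
          Algebra.TensorProduct.includeLeftRingHom.comp (algebraMap ℂ A) := rfl
      simp only [SpecC, cylinder, puncturedLine, Over.mk_hom, h, CommRingCat.ofHom_comp,
        Spec.map_comp, pullbackSpecIso_hom_fst_assoc]
  e ≪≫ SpecC.isoOfAlgEquiv ((AddMonoidAlgebra.scalarTensorEquiv ℂ A).restrictScalars ℂ)

/-- The spectrum of a factorial domain which is standard smooth of relative dimension two over `ℂ`
is a smooth factorial affine surface. -/
theorem IsSmoothFactorialAffineSurface.of_isStandardSmooth (A : Type) [CommRing A]
    [Algebra ℂ A] [IsDomain A] [UniqueFactorizationMonoid A]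
    [h : Algebra.IsStandardSmoothOfRelativeDimension 2 ℂ A] :
    IsSmoothFactorialAffineSurface (SpecC A) where
  isAffine := inferInstanceAs (IsAffine (Spec (CommRingCat.of A)))
  isIntegral := inferInstanceAs (IsIntegral (Spec (CommRingCat.of A)))
  smooth := by
    apply (HasRingHomProperty.Spec_iff (P := @SmoothOfRelativeDimension 2)).2
    apply RingHom.locally_of
    · exact RingHom.isStandardSmoothOfRelativeDimension_respectsIso
    · exact (RingHom.isStandardSmoothOfRelativeDimension_algebraMap 2).2 h
  factorial := by
    let e := (Scheme.ΓSpecIso (CommRingCat.of A)).commRingCatIsoToRingEquiv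
    exact e.symm.toMulEquiv.uniqueFactorizationMonoid ‹_›

/-! ### Roots of power series -/

/-- In a `ℚ`-algebra, `1 + g` has a `p`-th root for each power series `g` without constant term:
the binomial series of exponent `1 / p` in `g`. -/
lemma PowerSeries.exists_pow_eq_one_add {A : Type*} [CommRing A] [Algebra ℚ A] {p : ℕ} (hp : p ≠ 0)
    (g : PowerSeries A) (hg : PowerSeries.constantCoeff g = 0) :
    ∃ r : PowerSeries A, r ^ p = 1 + g := by
  have hs : PowerSeries.HasSubst g := .of_constantCoeff_zero' hg
  have hb (n : ℕ) : (PowerSeries.binomialSeries A (1 / p : ℚ)) ^ n =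
      PowerSeries.binomialSeries A (n * (1 / p) : ℚ) := by
    induction n with
    | zero => simp
    | succ n ih => rw [pow_succ, ih, ← PowerSeries.binomialSeries_add]; push_cast; ring_nf
  have hb' : (PowerSeries.binomialSeries A (1 / p : ℚ)) ^ p = 1 + PowerSeries.X := by
    rw [hb, mul_one_div_cancel (Nat.cast_ne_zero.2 hp)]
    simpa using PowerSeries.binomialSeries_nat (R := ℚ) (A := A) 1
  refine ⟨(PowerSeries.binomialSeries A (1 / p : ℚ)).subst g, ?_⟩
  rw [← PowerSeries.subst_pow hs, hb', PowerSeries.subst_add hs, PowerSeries.subst_X hs,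
    ← PowerSeries.coe_substAlgHom hs, map_one]

/-! ### Pole orders of polynomials in two functions -/

section degree

variable {R B : Type*} [CommRing R] [CommRing B]

/-- Evaluation of a polynomial in two variables with coefficients in `R` at `(X, Y)`; the inner
variable goes to `Y` and the outer one to `X`. -/
noncomputable def evalPair (f : R →+* B) (X Y : B) : Polynomial (Polynomial R) →+* B :=
  Polynomial.eval₂RingHom (Polynomial.eval₂RingHom f Y) X

@[simp] lemma evalPair_X (f : R →+* B) (X Y : B) : evalPair f X Y .X = X := by simp [evalPair]

@[simp] lemma evalPair_C_X (f : R →+* B) (X Y : B) : evalPair f X Y (.C .X) = Y := by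
  simp [evalPair]

@[simp] lemma evalPair_C_C (f : R →+* B) (X Y : B) (r : R) :
    evalPair f X Y (.C (.C r)) = f r := by simp [evalPair]

lemma map_evalPair {D : Type*} [CommRing D] (g : B →+* D) (f : R →+* B) (X Y : B)
    (h : Polynomial (Polynomial R)) :
    g (evalPair f X Y h) = evalPair (g.comp f) (g X) (g Y) h := by
  have : g.comp (evalPair f X Y) = evalPair (g.comp f) (g X) (g Y) := by
    ext <;> simp
  exact DFunLike.congr_fun this h

variable {p q : ℕ} (v : AddValuation B (WithTop ℤ))

/-- Two monomials `X ^ i * Y ^ j` and `X ^ i' * Y ^ j'` with `i, i' < p` of the same weight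
agree. -/
lemma eq_of_weight_eq (hpq : p.Coprime q) {i j i' j' : ℕ} (hi : i < p) (hi' : i' < p)
    (h : q * i + p * j = q * i' + p * j') : i = i' ∧ j = j' := by
  have h₁ : q * i ≡ q * i' [MOD p] := by
    have := congrArg (· % p) h
    simpa [Nat.ModEq, Nat.add_mul_mod_self_left] using this
  have h₂ : i = i' :=
    Nat.ModEq.eq_of_lt_of_lt (Nat.ModEq.cancel_left_of_coprime hpq h₁) hi hi'
  subst h₂
  exact ⟨rfl, Nat.eq_of_mul_eq_mul_left (by lia) (Nat.add_left_cancel h)⟩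

/-- If `X` and `Y` have poles of orders `q * k` and `p * k`, the monomials `X ^ i * Y ^ j` with
`i < p` have poles of distinct orders, so that the largest weight of a monomial determines the
valuation of a sum. -/
theorem valuation_evalPair (hpq : p.Coprime q) {f : R →+* B}
    (hf : ∀ r, r ≠ 0 → v (f r) = 0) {k : ℕ} (hk : 0 < k) {X Y : B}
    (hX : v X = ((-(q * k : ℕ) : ℤ) : WithTop ℤ))
    (hY : v Y = ((-(p * k : ℕ) : ℤ) : WithTop ℤ))
    {h : Polynomial (Polynomial R)} (h0 : h ≠ 0) (hdeg : h.degree < p) :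
    ∃ i j, i < p ∧ (h.coeff i).coeff j ≠ 0 ∧
      v (evalPair f X Y h) = ((-(k * (q * i + p * j) : ℕ) : ℤ) : WithTop ℤ) ∧
      ∀ i' j', (h.coeff i').coeff j' ≠ 0 → q * i' + p * j' ≤ q * i + p * j := by
  classical
  let S : Finset (Σ _ : ℕ, ℕ) := h.support.sigma fun i => (h.coeff i).support
  have hS (a : Σ _ : ℕ, ℕ) : a ∈ S ↔ (h.coeff a.1).coeff a.2 ≠ 0 := by
    simp only [S, Finset.mem_sigma, Polynomial.mem_support_iff, and_iff_right_iff_imp]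
    intro h1 h2
    simp [h2] at h1
  have hlt (a : Σ _ : ℕ, ℕ) (ha : a ∈ S) : a.1 < p := by
    rw [Finset.mem_sigma] at ha
    exact_mod_cast (Polynomial.le_degree_of_mem_supp _ ha.1).trans_lt hdeg
  have hne : S.Nonempty := by
    obtain ⟨i, hi⟩ := Polynomial.nonempty_support_iff.2 h0
    obtain ⟨j, hj⟩ := Polynomial.nonempty_support_iff.2 (Polynomial.mem_support_iff.1 hi)
    exact ⟨⟨i, j⟩, Finset.mem_sigma.2 ⟨hi, hj⟩⟩
  let w : (Σ _ : ℕ, ℕ) → ℕ := fun a => q * a.1 + p * a.2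
  let term : (Σ _ : ℕ, ℕ) → B := fun a => f ((h.coeff a.1).coeff a.2) * Y ^ a.2 * X ^ a.1
  obtain ⟨a, ha, hmax⟩ := S.exists_max_image w hne
  have hterm (b) (hb : b ∈ S) : v (term b) = ((-(k * w b : ℕ) : ℤ) : WithTop ℤ) := by
    simp only [term, AddValuation.map_mul, AddValuation.map_pow, hf _ ((hS b).1 hb), hX, hY, w]
    rw [zero_add, ← WithTop.coe_nsmul, ← WithTop.coe_nsmul, ← WithTop.coe_add]
    congr 1
    push_cast
    ring
  have hsum : evalPair f X Y h = ∑ b ∈ S, term b := by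
    rw [Finset.sum_sigma]
    simp only [evalPair, Polynomial.coe_eval₂RingHom, Polynomial.eval₂_eq_sum, Polynomial.sum,
      term, Finset.sum_mul]
  refine ⟨a.1, a.2, hlt a ha, (hS a).1 ha, ?_, fun i' j' h' => hmax ⟨i', j'⟩ ((hS _).2 h')⟩
  rw [hsum, ← Finset.add_sum_erase _ _ ha, AddValuation.map_add_eq_of_lt_left, hterm a ha]
  rw [hterm a ha]
  apply AddValuation.map_lt_sum _ (WithTop.coe_ne_top)
  intro b hb
  obtain ⟨hba, hb⟩ := Finset.mem_erase.1 hb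
  rw [hterm b hb, WithTop.coe_lt_coe, neg_lt_neg_iff, Nat.cast_lt]
  refine Nat.mul_lt_mul_of_pos_left ((hmax b hb).lt_of_ne fun hw => hba ?_) hk
  obtain ⟨h₁, h₂⟩ := eq_of_weight_eq hpq (hlt b hb) (hlt a ha) hw
  exact Sigma.ext h₁ (heq_of_eq h₂)

/-- A point of the curve `X ^ p + Y ^ q = z` over a ring of constants has all its poles at the
unique place at infinity. -/
lemma exists_pole_order (hpq : p.Coprime q) {X Y : B} (h0 : v (X ^ p + Y ^ q) = 0)
    (hp : p ≠ 0) (hq : q ≠ 0) (hY : v Y < 0) : ∃ k : ℕ, 0 < k ∧ v X = ((-(q * k : ℕ) : ℤ) : WithTop ℤ) ∧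
      v Y = ((-(p * k : ℕ) : ℤ) : WithTop ℤ) := by
  obtain ⟨b, hb⟩ := WithTop.ne_top_iff_exists.1 hY.ne_top
  rw [← hb] at hY
  have hb0 : b < 0 := by exact_mod_cast hY
  have hYq : v (Y ^ q) = ((q * b : ℤ) : WithTop ℤ) := by
    rw [AddValuation.map_pow, ← hb, ← WithTop.coe_nsmul, nsmul_eq_mul]
  have hlt : v (Y ^ q) < 0 := by
    rw [hYq]
    exact_mod_cast mul_neg_of_pos_of_neg (by positivity) hb0
  have hXY : v (X ^ p) = v (Y ^ q) := by
    by_contra hne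
    have := v.map_add_of_distinct_val hne
    rw [h0] at this
    exact absurd (this ▸ min_le_right _ _) hlt.not_ge
  have hX : v X ≠ ⊤ := by
    intro h
    rw [hYq, AddValuation.map_pow, h, ← Nat.succ_pred_eq_of_ne_zero hp, succ_nsmul,
      add_top] at hXY
    exact WithTop.top_ne_coe hXY
  obtain ⟨a, ha⟩ := WithTop.ne_top_iff_exists.1 hX
  rw [hYq, AddValuation.map_pow, ← ha, ← WithTop.coe_nsmul, nsmul_eq_mul, WithTop.coe_inj] at hXY
  obtain ⟨c, rfl⟩ : (p : ℤ) ∣ b :=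
    (Nat.isCoprime_iff_coprime.2 hpq).dvd_of_dvd_mul_left ⟨a, hXY.symm⟩
  have hc : c < 0 := neg_of_mul_neg_right hb0 (by positivity)
  obtain ⟨k, rfl⟩ : ∃ k : ℕ, c = -k := ⟨c.natAbs, by lia⟩
  refine ⟨k, by lia, ?_, ?_⟩
  · rw [← ha, WithTop.coe_inj]
    have hp' : (p : ℤ) ≠ 0 := by exact_mod_cast hp
    apply mul_left_cancel₀ hp'
    rw [hXY]
    push_cast
    ring
  · rw [← hb, WithTop.coe_inj]
    push_cast
    ring

end degree

/-! ### Units of Laurent polynomials -/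

namespace LaurentPolynomial

/-- The units of Laurent polynomials over a field are the nonzero monomials. -/
lemma exists_eq_C_mul_T_of_isUnit {K : Type*} [Field K] {r : K[T;T⁻¹]} (hr : IsUnit r) :
    ∃ (c : K) (n : ℤ), c ≠ 0 ∧ r = C c * T n := by
  obtain ⟨s, hrs⟩ := hr.exists_right_inv
  obtain ⟨n, f, hf⟩ := exists_T_pow r
  obtain ⟨m, g, hg⟩ := exists_T_pow s
  have hfg : f * g = Polynomial.X ^ (n + m) := by
    apply Polynomial.toLaurent_injective
    rw [map_mul, hf, hg, Polynomial.toLaurent_X_pow, mul_mul_mul_comm, hrs, one_mul, ← T_add]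
    simp
  obtain ⟨i, -, hi⟩ := (dvd_prime_pow Polynomial.prime_X _).1 ⟨g, hfg.symm⟩
  obtain ⟨u, hu⟩ := hi.symm
  obtain ⟨c, hc, hcu⟩ := Polynomial.isUnit_iff.1 u.isUnit
  refine ⟨c, i - n, hc.ne_zero, ?_⟩
  have : r = Polynomial.toLaurent f * T (-n) := by rw [hf, mul_T_assoc]; simp
  rw [this, ← hu, ← hcu, mul_comm (_ ^ _), Polynomial.toLaurent_C_mul_X_pow,
    mul_assoc, ← T_add, sub_eq_add_neg]

end LaurentPolynomial

/-! ### The valuation at infinity -/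

namespace SurfaceRing

variable {p q ℓ : ℕ}

/-- The projection of the surface to `ℂ^*` given by `1 / t`, on functions. -/
noncomputable def base (hℓ : ℓ ≠ 0) : ℂ[T;T⁻¹] →ₐ[ℂ] SurfaceRing p q ℓ :=
  LaurentPolynomial.liftUnit (Algebra.ofId ℂ _) (tUnit hℓ)⁻¹

lemma base_T_neg_one (hℓ : ℓ ≠ 0) : base hℓ (.T (-1)) = (t : SurfaceRing p q ℓ) := by
  simp [base]

lemma base_T (hℓ : ℓ ≠ 0) : base hℓ (.T ℓ) = (x ^ p + y ^ q : SurfaceRing p q ℓ) := by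
  apply ((isUnit_t hℓ).pow ℓ).mul_left_cancel
  rw [relation, ← base_T_neg_one hℓ, ← map_pow, ← map_mul, LaurentPolynomial.T_pow,
    ← LaurentPolynomial.T_add]
  simp

/-- The curve `x ^ p + y ^ q = s ^ ℓ` over `ℂ[s, s⁻¹]` has a valuation at infinity. Its ring of
functions maps to the ring of Laurent series in `τ` over `ℂ[s, s⁻¹]` by `y ↦ ε * τ⁻ᵖ` with
`ε ^ q = -1`, and `x ↦ τ^(-q) * r`, with a power series `r` such that
`r ^ p = 1 + s ^ ℓ * τ ^ (p * q)`. -/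
theorem exists_valuation (hp : p ≠ 0) (hq : q ≠ 0) (hpq : p.Coprime q) (hℓ : ℓ ≠ 0) :
    ∃ v : AddValuation (SurfaceRing p q ℓ) (WithTop ℤ), (∀ r, r ≠ 0 → v (base hℓ r) = 0) ∧
      v x = ((-q : ℤ) : WithTop ℤ) ∧ v y = ((-p : ℤ) : WithTop ℤ) := by
  obtain ⟨ε, hε⟩ := IsAlgClosed.exists_pow_nat_eq (-1 : ℂ) (Nat.pos_of_ne_zero hq)
  let g : PowerSeries ℂ[T;T⁻¹] := PowerSeries.C (.T ℓ) * PowerSeries.X ^ (p * q)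
  obtain ⟨r, hr⟩ := PowerSeries.exists_pow_eq_one_add hp g (by simp [g, hp, hq])
  have hψ₀ : HahnSeries.C (Γ := ℤ) (LaurentPolynomial.T (-1) : ℂ[T;T⁻¹]) ^ ℓ *
      ((HahnSeries.single (-q : ℤ) 1 * HahnSeries.ofPowerSeries ℤ _ r) ^ p +
        HahnSeries.single (-p : ℤ) (.C ε) ^ q) = 1 := by
    have h₁ : (p • (-q : ℤ)) + (p * q : ℕ) = 0 := by simp
    have h₂ : (p • (-q : ℤ)) = q • (-p : ℤ) := by simp [mul_comm]
    have h₃ : HahnSeries.single (0 : ℤ) (1 : ℂ[T;T⁻¹]) = 1 := rfl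
    rw [mul_pow, ← map_pow (HahnSeries.ofPowerSeries ℤ _), hr, HahnSeries.single_pow,
      HahnSeries.single_pow, ← map_pow LaurentPolynomial.C, hε, map_add, map_one, map_mul,
      HahnSeries.ofPowerSeries_C, HahnSeries.ofPowerSeries_X_pow, one_pow,
      mul_add (HahnSeries.single _ _), mul_one, mul_left_comm, HahnSeries.single_mul_single, h₁,
      h₂, mul_one, h₃, mul_one, map_neg, map_one LaurentPolynomial.C, HahnSeries.single_neg,
      add_right_comm, add_neg_cancel, zero_add, ← map_pow, LaurentPolynomial.T_pow, ← map_mul,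
      ← LaurentPolynomial.T_add]
    simp
  let ψ : SurfaceRing p q ℓ →ₐ[ℂ] LaurentSeries ℂ[T;T⁻¹] := lift _ _ _ hψ₀
  have hψ (r) : ψ (base hℓ r) = HahnSeries.C r := by
    have hcomm (a : ℂ) : HahnSeries.C (algebraMap ℂ ℂ[T;T⁻¹] a) =
        algebraMap ℂ (LaurentSeries ℂ[T;T⁻¹]) a := by
      rw [HahnSeries.algebraMap_apply', PowerSeries.algebraMap_apply, HahnSeries.ofPowerSeries_C]
    let c : ℂ[T;T⁻¹] →ₐ[ℂ] LaurentSeries ℂ[T;T⁻¹] := { HahnSeries.C with commutes' := hcomm }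
    have hc (r) : c r = HahnSeries.C r := rfl
    have : ψ.comp (base hℓ) = c := by
      apply LaurentPolynomial.algHom_ext_T
      · intro a
        rw [LaurentPolynomial.C_eq_algebraMap, AlgHom.commutes, AlgHom.commutes]
      · have h₁ : IsUnit (c (.T (-1))) := (LaurentPolynomial.isUnit_T (-1)).map c
        apply h₁.mul_left_cancel
        rw [← map_mul c, ← LaurentPolynomial.T_add, neg_add_cancel, LaurentPolynomial.T_zero,
          map_one, hc, ← lift_t _ _ _ hψ₀, ← base_T_neg_one hℓ]
        change ψ.comp (base hℓ) _ * _ = 1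
        rw [← map_mul, ← LaurentPolynomial.T_add, neg_add_cancel, LaurentPolynomial.T_zero,
          map_one]
    exact DFunLike.congr_fun this r
  let v := (HahnSeries.addVal ℤ ℂ[T;T⁻¹]).comap (ψ : SurfaceRing p q ℓ →+* _)
  have hv (b) : v b = HahnSeries.addVal ℤ ℂ[T;T⁻¹] (ψ b) := rfl
  have h₁ (r) (h : r ≠ 0) : v (base hℓ r) = 0 := by
    rw [hv, hψ, HahnSeries.addVal_apply, HahnSeries.C_apply, HahnSeries.orderTop_single h]
    rfl
  have hy : v y = ((-p : ℤ) : WithTop ℤ) := by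
    rw [hv, lift_y, HahnSeries.addVal_apply, HahnSeries.orderTop_single]
    rw [Ne, map_eq_zero_iff _ LaurentPolynomial.C_injective]
    rintro rfl
    simp [hq] at hε
  obtain ⟨k, hk, hkx, hky⟩ := exists_pole_order v hpq
    (by rw [← base_T hℓ]; exact h₁ _ (LaurentPolynomial.isUnit_T _).ne_zero) hp hq
    (by rw [hy]; exact_mod_cast (by lia : (-p : ℤ) < 0))
  have : k = 1 := by
    rw [hy, WithTop.coe_inj] at hky
    have : p = p * k := by exact_mod_cast neg_injective hky
    exact (Nat.eq_of_mul_eq_mul_left (Nat.pos_of_ne_zero hp) (by rw [← this, mul_one])).symm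
  subst this
  exact ⟨v, h₁, by simpa using hkx, hy⟩

end SurfaceRing

/-! ### Functions and units as combinations of monomials -/

lemma Polynomial.coeff_C_mul_X_add_C_pow {A : Type*} [CommRing A] (a g : A) (n m : ℕ) :
    ((C a * X + C g) ^ n).coeff m = a ^ m * g ^ (n - m) * n.choose m := by
  rw [add_pow, finsetSum_coeff]
  have (k : ℕ) : (C a * X) ^ k * C g ^ (n - k) * ((n.choose k : ℕ) : Polynomial A) =
      C (a ^ k * g ^ (n - k) * n.choose k) * X ^ k := by
    simp only [map_mul, map_pow, map_natCast]
    ring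
  simp only [this, coeff_C_mul_X_pow]
  rw [Finset.sum_ite_eq]
  split_ifs with h
  · rfl
  · rw [Nat.choose_eq_zero_of_lt (by simpa using h)]
    simp

namespace SurfaceRing

variable {p q ℓ : ℕ}

/-- The ring of functions is spanned over `ℂ[s, s⁻¹]` by the monomials `x ^ i * y ^ j`, `i < p`. -/
theorem exists_evalPair_eq (hp : p ≠ 0) (hℓ : ℓ ≠ 0) (b : SurfaceRing p q ℓ) :
    ∃ h : Polynomial (Polynomial ℂ[T;T⁻¹]), h.degree < p ∧
      evalPair (base (p := p) (q := q) hℓ).toRingHom x y h = b := by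
  set ev := evalPair (base (p := p) (q := q) hℓ).toRingHom x y with hev
  have hsurj : ∃ h, ev h = b := by
    obtain ⟨w, rfl⟩ := Ideal.Quotient.mk_surjective b
    change _ ∈ ev.range
    induction w using MvPolynomial.induction_on with
    | C a =>
      refine ⟨.C (.C (.C a)), ?_⟩
      rw [hev, evalPair_C_C]
      exact (base hℓ).commutes a
    | add f g hf hg => rw [map_add]; exact add_mem hf hg
    | mul_X f i hf =>
      rw [map_mul]
      refine mul_mem hf ?_
      fin_cases i
      · exact ⟨.X, evalPair_X ..⟩
      · exact ⟨.C .X, evalPair_C_X ..⟩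
      · exact ⟨.C (.C (.T (-1))), (evalPair_C_C ..).trans (base_T_neg_one hℓ)⟩
  obtain ⟨h, rfl⟩ := hsurj
  -- reduce modulo the equation of the curve, which is monic in `x`
  let g : Polynomial (Polynomial ℂ[T;T⁻¹]) := .X ^ p - .C (.C (.T ℓ) - .X ^ q)
  have hg : g.Monic := Polynomial.monic_X_pow_sub_C _ hp
  have hg0 : ev g = 0 := by
    simp [g, hev, base_T]
  refine ⟨h %ₘ g, ?_, ?_⟩
  · refine (Polynomial.degree_modByMonic_lt h hg).trans_eq ?_
    rw [Polynomial.degree_X_pow_sub_C (Nat.pos_of_ne_zero hp)]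
  · rw [Polynomial.modByMonic_eq_sub_mul_div, map_sub, map_mul, hg0, zero_mul, sub_zero]

lemma base_injective (hp : p ≠ 0) (hq : q ≠ 0) (hpq : p.Coprime q) (hℓ : ℓ ≠ 0) :
    Function.Injective (base hℓ : ℂ[T;T⁻¹] →ₐ[ℂ] SurfaceRing p q ℓ) := by
  obtain ⟨v, hv, -⟩ := exists_valuation hp hq hpq hℓ
  rw [injective_iff_map_eq_zero]
  intro r hr
  by_contra h
  have := hv r h
  simp [hr] at this

/-- A function without poles at infinity is constant on the fibres of the projection to `ℂ^*`. -/
lemma mem_range_base_of_nonneg (hp : p ≠ 0) (hq : q ≠ 0) (hpq : p.Coprime q) (hℓ : ℓ ≠ 0)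
    {v : AddValuation (SurfaceRing p q ℓ) (WithTop ℤ)} (hv : ∀ r, r ≠ 0 → v (base hℓ r) = 0)
    (hx : v x = ((-q : ℤ) : WithTop ℤ)) (hy : v y = ((-p : ℤ) : WithTop ℤ))
    {b : SurfaceRing p q ℓ} (hb : 0 ≤ v b) : ∃ r, base hℓ r = b := by
  obtain ⟨h, hdeg, rfl⟩ := exists_evalPair_eq hp hℓ b
  by_cases h0 : h = 0
  · exact ⟨0, by simp [h0]⟩
  obtain ⟨i, j, -, -, hval, hmax⟩ := valuation_evalPair v hpq (f := (base hℓ).toRingHom) hv one_pos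
    (by simpa using hx) (by simpa using hy) h0 hdeg
  rw [hval, one_mul] at hb
  have hw : q * i + p * j = 0 := by
    have : (0 : ℤ) ≤ -(q * i + p * j : ℕ) := by exact_mod_cast hb
    lia
  rw [hw] at hmax
  refine ⟨(h.coeff 0).coeff 0, ?_⟩
  have : h = .C (.C ((h.coeff 0).coeff 0)) := by
    ext i' j' : 2
    by_cases hc : (h.coeff i').coeff j' = 0
    · rw [hc, Polynomial.coeff_C]
      split_ifs with hi
      · rw [Polynomial.coeff_C]
        split_ifs with hj
        · rw [← hc, hi, hj]
        · rfl
      · simp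
    · have := hmax i' j' hc
      have hi : i' = 0 := by
        by_contra hi
        have := Nat.mul_pos (Nat.pos_of_ne_zero hq) (Nat.pos_of_ne_zero hi)
        lia
      have hj : j' = 0 := by
        by_contra hj
        have := Nat.mul_pos (Nat.pos_of_ne_zero hp) (Nat.pos_of_ne_zero hj)
        lia
      simp [hi, hj]
  conv_rhs => rw [this]
  simp

/-- The units of the ring of functions come from `ℂ^*`. -/
lemma exists_isUnit_base_eq (hp : p ≠ 0) (hq : q ≠ 0) (hpq : p.Coprime q) (hℓ : ℓ ≠ 0)
    {b : SurfaceRing p q ℓ} (hb : IsUnit b) : ∃ r, IsUnit r ∧ base hℓ r = b := by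
  obtain ⟨v, hv, hx, hy⟩ := exists_valuation hp hq hpq hℓ
  have hle (c : SurfaceRing p q ℓ) (hc : c ≠ 0) : v c ≤ 0 := by
    obtain ⟨h, hdeg, rfl⟩ := exists_evalPair_eq hp hℓ c
    have h0 : h ≠ 0 := by rintro rfl; simp at hc
    obtain ⟨i, j, -, -, hval, -⟩ := valuation_evalPair v hpq (f := (base hℓ).toRingHom) hv one_pos
      (by simpa using hx) (by simpa using hy) h0 hdeg
    rw [hval]
    exact_mod_cast (by lia)
  have hge (c d : SurfaceRing p q ℓ) (hcd : c * d = 1) : 0 ≤ v c := by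
    have hd : d ≠ 0 := by
      rintro rfl
      have h1 := v.map_one
      rw [← hcd, mul_zero, v.map_zero] at h1
      simp at h1
    have h1 := congrArg v hcd
    rw [v.map_mul, v.map_one] at h1
    calc (0 : WithTop ℤ) = v c + v d := h1.symm
      _ ≤ v c + 0 := by gcongr; exact hle d hd
      _ = v c := add_zero _
  obtain ⟨d, hd⟩ := hb.exists_right_inv
  obtain ⟨r, rfl⟩ := mem_range_base_of_nonneg hp hq hpq hℓ hv hx hy (hge b d hd)
  obtain ⟨s, rfl⟩ := mem_range_base_of_nonneg hp hq hpq hℓ hv hx hy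
    (hge d _ (by rw [mul_comm, hd]))
  refine ⟨r, IsUnit.of_mul_eq_one s (base_injective hp hq hpq hℓ ?_), rfl⟩
  rw [map_mul, hd, map_one]

/-- An isomorphism of the surfaces lies over an endomorphism `s ↦ c * s ^ k` of `ℂ^*`. -/
lemma exists_base_hom {ℓ' : ℕ} (hp : p ≠ 0) (hq : q ≠ 0) (hpq : p.Coprime q) (hℓ : ℓ ≠ 0)
    (hℓ' : ℓ' ≠ 0) (e : SurfaceRing p q ℓ ≃ₐ[ℂ] SurfaceRing p q ℓ') :
    ∃ σ : ℂ[T;T⁻¹] →ₐ[ℂ] ℂ[T;T⁻¹], ∀ r, e (base hℓ r) = base hℓ' (σ r) := by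
  obtain ⟨u, ⟨u, rfl⟩, hu'⟩ := exists_isUnit_base_eq hp hq hpq hℓ'
    (((LaurentPolynomial.isUnit_T 1).map (base hℓ : _ →ₐ[ℂ] SurfaceRing p q ℓ)).map e)
  refine ⟨LaurentPolynomial.liftUnit (Algebra.ofId ℂ _) u, fun r => ?_⟩
  have : (e : SurfaceRing p q ℓ →ₐ[ℂ] SurfaceRing p q ℓ').comp (base hℓ) =
      (base hℓ').comp (LaurentPolynomial.liftUnit (Algebra.ofId ℂ _) u) := by
    apply LaurentPolynomial.algHom_ext_T
    · intro a
      rw [LaurentPolynomial.C_eq_algebraMap, AlgHom.commutes, AlgHom.commutes]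
    · simpa using hu'.symm
  exact DFunLike.congr_fun this r

end SurfaceRing

/-- An algebra endomorphism of `ℂ[T;T⁻¹]` maps `T` to a monomial of some degree `k`, and is
multiplication by `k` on degrees of monomials. -/
lemma LaurentPolynomial.exists_map_T (σ : ℂ[T;T⁻¹] →ₐ[ℂ] ℂ[T;T⁻¹]) :
    ∃ k : ℤ, ∀ n, ∃ c : ℂ, c ≠ 0 ∧ σ (T n) = C c * T (k * n) := by
  obtain ⟨c, k, hc, hk⟩ := exists_eq_C_mul_T_of_isUnit ((isUnit_T 1).map σ)
  have hpos (n : ℕ) : σ (T n) = C (c ^ n) * T (k * n) := by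
    rw [← mul_one (n : ℤ), ← T_pow, map_pow, hk, mul_pow, T_pow, map_pow, mul_one, mul_comm k]
  refine ⟨k, fun n => ?_⟩
  obtain ⟨m, rfl | rfl⟩ := n.eq_nat_or_neg
  · exact ⟨c ^ m, pow_ne_zero _ hc, hpos m⟩
  · refine ⟨(c ^ m)⁻¹, inv_ne_zero (pow_ne_zero _ hc), ?_⟩
    apply ((isUnit_T (m : ℤ)).map σ).mul_left_cancel
    rw [← map_mul, ← T_add, hpos, mul_mul_mul_comm, ← map_mul, ← T_add,
      mul_inv_cancel₀ (pow_ne_zero _ hc)]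
    simp

lemma LaurentPolynomial.eq_of_C_mul_T_eq {c d : ℂ} (hc : c ≠ 0) {m n : ℤ}
    (h : C c * T m = C d * T n) :
    m = n := by
  have hd : d ≠ 0 := by
    rintro rfl
    rw [map_zero, zero_mul, (isUnit_T m).mul_left_eq_zero, map_eq_zero_iff _ C_injective] at h
    exact hc h
  have := congrArg degree h
  rw [degree_C_mul_T _ _ hc, degree_C_mul_T _ _ hd] at this
  exact_mod_cast this

/-! ### Isomorphisms between the surfaces -/

namespace SurfaceRing

variable {p q ℓ : ℕ}

/-- A generating pair satisfying the equation of the curve has the pole orders of `(x, y)`: the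
pole orders of all functions are multiples of a number `k`, and those of `x` and `y` are `q` and
`p`, so that `k = 1`. -/
lemma valuation_of_generating (hp : p ≠ 0) (hq : q ≠ 0) (hpq : p.Coprime q) (hℓ : ℓ ≠ 0)
    {v : AddValuation (SurfaceRing p q ℓ) (WithTop ℤ)} (hv : ∀ r, r ≠ 0 → v (base hℓ r) = 0)
    (hx : v x = ((-q : ℤ) : WithTop ℤ)) (hy : v y = ((-p : ℤ) : WithTop ℤ))
    {σ : ℂ[T;T⁻¹] →+* ℂ[T;T⁻¹]} (hσ : Function.Injective σ) {X Y : SurfaceRing p q ℓ}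
    (hgen : ∀ b, ∃ h : Polynomial (Polynomial ℂ[T;T⁻¹]), h.degree < p ∧
      evalPair ((base hℓ).toRingHom.comp σ) X Y h = b)
    {z : ℂ[T;T⁻¹]} (hz : z ≠ 0) (hrel : X ^ p + Y ^ q = base hℓ z) :
    v X = ((-q : ℤ) : WithTop ℤ) ∧ v Y = ((-p : ℤ) : WithTop ℤ) := by
  have hv0 : v (X ^ p + Y ^ q) = 0 := by rw [hrel, hv z hz]
  have hYneg : v Y < 0 := by
    by_contra hY
    rw [not_lt] at hY
    have hX : 0 ≤ v X := by
      by_contra hX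
      rw [not_le] at hX
      rw [add_comm] at hv0
      obtain ⟨k, hk, hk', -⟩ := exists_pole_order v hpq.symm hv0 hq hp hX
      rw [hk'] at hY
      have h₁ : (0 : ℤ) ≤ -(p * k : ℕ) := by exact_mod_cast hY
      have h₂ := Nat.mul_pos (Nat.pos_of_ne_zero hp) hk
      lia
    obtain ⟨r, rfl⟩ := mem_range_base_of_nonneg hp hq hpq hℓ hv hx hy hX
    obtain ⟨s, rfl⟩ := mem_range_base_of_nonneg hp hq hpq hℓ hv hx hy hY
    -- otherwise all functions would come from `ℂ^*`, but `y` does not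
    obtain ⟨h, -, hh⟩ := hgen y
    have : (y : SurfaceRing p q ℓ) = base hℓ (evalPair σ r s h) := by
      rw [← hh]
      exact (map_evalPair (base hℓ).toRingHom σ r s h).symm
    by_cases h0 : evalPair σ r s h = 0
    · rw [this, h0, map_zero, v.map_zero] at hy
      exact WithTop.top_ne_coe hy
    · rw [this, hv _ h0] at hy
      have : (0 : ℤ) = -p := by exact_mod_cast hy
      lia
  obtain ⟨k, hk, hX, hY⟩ := exists_pole_order v hpq hv0 hp hq hYneg
  have hdvd (b : SurfaceRing p q ℓ) (n : ℕ) (hb : v b = ((-n : ℤ) : WithTop ℤ)) : k ∣ n := by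
    obtain ⟨h, hdeg, rfl⟩ := hgen b
    have h0 : h ≠ 0 := by
      rintro rfl
      rw [map_zero, v.map_zero] at hb
      exact WithTop.top_ne_coe hb
    obtain ⟨i, j, -, -, hval, -⟩ := valuation_evalPair v hpq
      (f := (base hℓ).toRingHom.comp σ)
      (fun r hr => hv _ (by rwa [Ne, map_eq_zero_iff _ hσ])) hk hX hY h0 hdeg
    rw [hb, WithTop.coe_inj, neg_inj] at hval
    exact ⟨_, by exact_mod_cast hval⟩
  have hk1 : k = 1 := Nat.eq_one_of_dvd_coprimes hpq (hdvd y p hy) (hdvd x q hx)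
  subst hk1
  exact ⟨by simpa using hX, by simpa using hY⟩

/-- If `p < q`, a pair of functions with the pole orders of `(x, y)` has the form
`(α * x + g(y), β * y + γ)` with `α ≠ 0`. -/
lemma exists_eq_of_valuation (hp : 2 ≤ p) (hlt : p < q) (hpq : p.Coprime q) (hℓ : ℓ ≠ 0)
    {v : AddValuation (SurfaceRing p q ℓ) (WithTop ℤ)} (hv : ∀ r, r ≠ 0 → v (base hℓ r) = 0)
    (hx : v x = ((-q : ℤ) : WithTop ℤ)) (hy : v y = ((-p : ℤ) : WithTop ℤ))
    {X Y : SurfaceRing p q ℓ} (hX : v X = ((-q : ℤ) : WithTop ℤ))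
    (hY : v Y = ((-p : ℤ) : WithTop ℤ)) :
    ∃ (α β γ : ℂ[T;T⁻¹]) (g : Polynomial ℂ[T;T⁻¹]), α ≠ 0 ∧
      evalPair (base hℓ).toRingHom x y (.C (.C α) * .X + .C g) = X ∧
      evalPair (base hℓ).toRingHom x y (.C (.C β * .X + .C γ)) = Y := by
  have main (b : SurfaceRing p q ℓ) (n : ℕ) (hb : v b = ((-n : ℤ) : WithTop ℤ)) :
      ∃ h : Polynomial (Polynomial ℂ[T;T⁻¹]), evalPair (base hℓ).toRingHom x y h = b ∧
        (∃ i j, q * i + p * j = n ∧ (h.coeff i).coeff j ≠ 0) ∧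
        ∀ i j, n < q * i + p * j → (h.coeff i).coeff j = 0 := by
    obtain ⟨h, hdeg, rfl⟩ := exists_evalPair_eq (by lia) hℓ b
    have h0 : h ≠ 0 := by
      rintro rfl
      rw [map_zero, v.map_zero] at hb
      exact WithTop.top_ne_coe hb
    obtain ⟨i, j, -, hij, hval, hmax⟩ := valuation_evalPair v hpq (f := (base hℓ).toRingHom) hv
      one_pos (by simpa using hx) (by simpa using hy) h0 hdeg
    rw [hb, WithTop.coe_inj, neg_inj, one_mul, Nat.cast_inj] at hval
    refine ⟨h, rfl, ⟨i, j, hval.symm, hij⟩, fun i' j' h' => ?_⟩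
    by_contra hc
    have := hmax i' j' hc
    lia
  obtain ⟨f, rfl, ⟨i, j, hij, hα⟩, hX0⟩ := main X q hX
  obtain ⟨h, rfl, -, hY0⟩ := main Y p hY
  have hi : i = 1 ∧ j = 0 := by
    have hi0 : i ≠ 0 := by
      rintro rfl
      have : p ∣ q := ⟨j, by lia⟩
      have := Nat.eq_one_of_dvd_coprimes hpq dvd_rfl this
      lia
    have hi1 : i < 2 := by
      by_contra hi
      have := Nat.mul_le_mul_left q (not_lt.1 hi)
      lia
    obtain rfl : i = 1 := by lia
    refine ⟨rfl, ?_⟩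
    have : p * j = 0 := by lia
    exact (Nat.mul_eq_zero.1 this).resolve_left (by lia)
  rw [hi.1, hi.2] at hα
  refine ⟨(f.coeff 1).coeff 0, (h.coeff 0).coeff 1, (h.coeff 0).coeff 0, f.coeff 0, hα,
    congrArg _ ?_, congrArg _ ?_⟩
  · ext i j : 2
    obtain rfl | rfl | ⟨i, rfl⟩ : i = 0 ∨ i = 1 ∨ ∃ i', i = i' + 2 := by
      rcases i with _ | _ | i <;> simp
    · simp
    · obtain rfl | hj := Nat.eq_zero_or_pos j
      · simp
      · rw [hX0 1 j (by nlinarith)]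
        simp [Polynomial.coeff_C, hj.ne']
    · rw [hX0 (i + 2) j (by nlinarith)]
      simp
  · ext i j : 2
    obtain rfl | ⟨i, rfl⟩ : i = 0 ∨ ∃ i', i = i' + 1 := by
      rcases i with _ | i <;> simp
    · obtain rfl | rfl | ⟨j, rfl⟩ : j = 0 ∨ j = 1 ∨ ∃ j', j = j' + 2 := by
        rcases j with _ | _ | j <;> simp
      · simp
      · simp
      · rw [hY0 0 (j + 2) (by nlinarith)]
        simp [Polynomial.coeff_C]
    · rw [hY0 (i + 1) j (by nlinarith)]
      simp

/-- The equation of the curve for the pair `(α * x + g(y), β * y + γ)`, compared with the one for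
`(x, y)`, has no terms in `x ^ (p - 1)` and `y ^ (q - 1)`, so that `g` and `γ` vanish. -/
lemma exists_pow_mul_eq (hp : 2 ≤ p) (hlt : p < q) (hpq : p.Coprime q) (hℓ : ℓ ≠ 0)
    {α β γ z : ℂ[T;T⁻¹]} {g : Polynomial ℂ[T;T⁻¹]} (hα : α ≠ 0)
    (hrel : evalPair (base (p := p) (q := q) hℓ).toRingHom x y (.C (.C α) * .X + .C g) ^ p +
      evalPair (base hℓ).toRingHom x y (.C (.C β * .X + .C γ)) ^ q = base hℓ z) :
    z = α ^ p * .T ℓ ∧ z = β ^ q * .T ℓ := by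
  obtain ⟨v, hv, hx, hy⟩ := exists_valuation (p := p) (q := q) (by lia) (by lia) hpq hℓ
  have : CharZero ℂ[T;T⁻¹] := algebraRat.charZero _
  let S : Polynomial ℂ[T;T⁻¹] := (.C β * .X + .C γ) ^ q - .C z - .C (α ^ p) * (.X ^ q - .C (.T ℓ))
  let H : Polynomial (Polynomial ℂ[T;T⁻¹]) :=
    (.C (.C α) * .X + .C g) ^ p - .C (.C (α ^ p)) * .X ^ p + .C S
  -- `H` represents the difference of the two equations, with the terms in `x ^ p` cancelled
  have hHc (m : ℕ) (hm : m ≠ 0) (hm' : m ≠ p) :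
      H.coeff m = .C α ^ m * g ^ (p - m) * p.choose m := by
    simp only [H, Polynomial.coeff_add, Polynomial.coeff_sub, Polynomial.coeff_C_mul_X_add_C_pow,
      Polynomial.coeff_C_mul, Polynomial.coeff_X_pow, Polynomial.coeff_C, if_neg hm, if_neg hm']
    simp
  have hdeg : H.degree < p := by
    rw [Polynomial.degree_lt_iff_coeff_zero]
    intro m hm
    obtain rfl | hm' := eq_or_ne m p
    · simp only [H, Polynomial.coeff_add, Polynomial.coeff_sub,
        Polynomial.coeff_C_mul_X_add_C_pow, Polynomial.coeff_C_mul, Polynomial.coeff_X_pow,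
        Polynomial.coeff_C, if_neg (show m ≠ 0 by lia)]
      simp
    · rw [hHc m (by lia) hm', Nat.choose_eq_zero_of_lt (by lia)]
      simp
  have hev : evalPair (base (p := p) (q := q) hℓ).toRingHom x y H = 0 := by
    have hb : base (p := p) (q := q) hℓ (.T ℓ) = x ^ p + y ^ q := base_T hℓ
    simp only [H, S, map_add, map_sub, map_mul, map_pow, evalPair_X, evalPair_C_X,
      evalPair_C_C] at hrel ⊢
    simp only [AlgHom.toRingHom_eq_coe, RingHom.coe_coe, hb] at hrel ⊢
    linear_combination hrel
  have hH : H = 0 := by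
    by_contra h0
    obtain ⟨i, j, -, -, hval, -⟩ := valuation_evalPair v hpq (f := (base hℓ).toRingHom) hv
      one_pos (by simpa using hx) (by simpa using hy) h0 hdeg
    rw [hev, v.map_zero] at hval
    exact WithTop.top_ne_coe hval
  have hg : g = 0 := by
    have := hHc (p - 1) (by lia) (by lia)
    rw [hH, Polynomial.coeff_zero, Nat.sub_sub_self (by lia), pow_one,
      Nat.choose_symm_of_eq_add (n := p) (a := p - 1) (b := 1) (by lia),
      Nat.choose_one_right] at this
    have hp0 : ((p : ℕ) : Polynomial ℂ[T;T⁻¹]) ≠ 0 :=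
      Nat.cast_ne_zero.2 (by lia)
    have hα' : (.C α : Polynomial ℂ[T;T⁻¹]) ^ (p - 1) ≠ 0 := pow_ne_zero _ (by simpa using hα)
    simpa [hp0, hα'] using this.symm
  have hS : S = 0 := by
    have := congrArg (fun f => f.coeff 0) hH
    simp only [H, hg, Polynomial.coeff_add, Polynomial.coeff_sub,
      Polynomial.coeff_C_mul_X_add_C_pow, Polynomial.coeff_C_mul, Polynomial.coeff_X_pow,
      Polynomial.coeff_C_zero, Polynomial.coeff_zero] at this
    simpa [show p ≠ 0 by lia, show 0 ≠ p by lia] using this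
  have hSc (m : ℕ) : β ^ m * γ ^ (q - m) * q.choose m - (if m = 0 then z else 0) -
      α ^ p * ((if m = q then 1 else 0) - if m = 0 then .T ℓ else 0) = 0 := by
    have := congrArg (fun f => f.coeff m) hS
    simpa only [S, Polynomial.coeff_sub, Polynomial.coeff_C_mul_X_add_C_pow,
      Polynomial.coeff_C_mul, Polynomial.coeff_X_pow, Polynomial.coeff_C,
      Polynomial.coeff_zero] using this
  have h₁ : β ^ q = α ^ p := by
    have := hSc q
    simp only [Nat.sub_self, pow_zero, Nat.choose_self, if_neg (show q ≠ 0 by lia), if_true] at this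
    simpa [sub_eq_zero] using this
  have hγ : γ = 0 := by
    have := hSc (q - 1)
    rw [Nat.sub_sub_self (by lia), pow_one,
      Nat.choose_symm_of_eq_add (n := q) (a := q - 1) (b := 1) (by lia), Nat.choose_one_right,
      if_neg (by lia), if_neg (by lia), if_neg (by lia)] at this
    have hq0 : ((q : ℕ) : ℂ[T;T⁻¹]) ≠ 0 :=
      Nat.cast_ne_zero.2 (by lia)
    have hβ : β ≠ 0 := by
      rintro rfl
      rw [zero_pow (by lia)] at h₁
      exact pow_ne_zero p hα h₁.symm
    simpa [hq0, hβ] using this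
  have h₂ : z = α ^ p * .T ℓ := by
    have := hSc 0
    rw [hγ, if_pos rfl, if_neg (by lia), if_pos rfl, Nat.sub_zero, zero_pow (by lia)] at this
    linear_combination -this
  exact ⟨h₂, h₁ ▸ h₂⟩

/-- If `c * T ^ n` is `T` times a `p`-th power, then `p` divides `n - 1`. -/
lemma dvd_of_pow_mul_T {α : ℂ[T;T⁻¹]} {c : ℂ} (hc : c ≠ 0) {n : ℤ} (hp : p ≠ 0)
    (h : LaurentPolynomial.C c * .T n = α ^ p * .T 1) : (p : ℤ) ∣ n - 1 := by
  have hα : IsUnit α := by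
    have h₁ : IsUnit (LaurentPolynomial.C c * .T n) :=
      (hc.isUnit.map LaurentPolynomial.C).mul (LaurentPolynomial.isUnit_T n)
    rw [h] at h₁
    exact (isUnit_pow_iff hp).1 (isUnit_of_mul_isUnit_left h₁)
  obtain ⟨d, m, hd, rfl⟩ := LaurentPolynomial.exists_eq_C_mul_T_of_isUnit hα
  rw [mul_pow, ← map_pow, LaurentPolynomial.T_pow, mul_assoc, ← LaurentPolynomial.T_add] at h
  exact ⟨m, by rw [LaurentPolynomial.eq_of_C_mul_T_eq hc h]; ring⟩

/-- For `p < q`, an isomorphism of the surfaces forces `ℓ ≡ ±1` modulo `p * q`; the sign is the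
exponent of the automorphism of `ℂ^*` under the isomorphism. -/
theorem dvd_of_algEquiv_of_lt (hp : 2 ≤ p) (hlt : p < q) (hpq : p.Coprime q) (hℓ : ℓ ≠ 0)
    (e : SurfaceRing p q ℓ ≃ₐ[ℂ] SurfaceRing p q 1) :
    ((p * q : ℕ) : ℤ) ∣ ℓ - 1 ∨ ((p * q : ℕ) : ℤ) ∣ ℓ + 1 := by
  have hp0 : p ≠ 0 := by lia
  have hq0 : q ≠ 0 := by lia
  obtain ⟨σ, hσ⟩ := exists_base_hom hp0 hq0 hpq hℓ one_ne_zero e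
  obtain ⟨σ', hσ'⟩ := exists_base_hom hp0 hq0 hpq one_ne_zero hℓ e.symm
  obtain ⟨k, hk⟩ := LaurentPolynomial.exists_map_T σ
  obtain ⟨k', hk'⟩ := LaurentPolynomial.exists_map_T σ'
  have hinj := base_injective hp0 hq0 hpq hℓ
  have hinj₁ := base_injective hp0 hq0 hpq one_ne_zero
  have hσinj : Function.Injective σ := by
    intro r s hrs
    apply hinj
    apply e.injective
    rw [hσ, hσ, hrs]
  -- the endomorphisms of `ℂ^*` under `e` and its inverse are inverse to each other
  have hkk : k * k' = 1 := by
    have h₁ : σ (σ' (.T 1)) = .T 1 := by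
      apply hinj₁
      rw [← hσ, ← hσ', e.apply_symm_apply]
    obtain ⟨c, hc, h₂⟩ := hk' 1
    obtain ⟨d, hd, h₃⟩ := hk (k' * 1)
    rw [h₂, map_mul, h₃, LaurentPolynomial.C_eq_algebraMap, AlgHom.commutes,
      ← LaurentPolynomial.C_eq_algebraMap, ← mul_assoc, ← map_mul,
      ← one_mul (LaurentPolynomial.T 1), ← map_one LaurentPolynomial.C] at h₁
    have := LaurentPolynomial.eq_of_C_mul_T_eq (mul_ne_zero hc hd) h₁
    lia
  obtain ⟨v, hv, hx, hy⟩ := exists_valuation (p := p) (q := q) hp0 hq0 hpq one_ne_zero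
  have hrel : e x ^ p + e y ^ q = base one_ne_zero (σ (.T ℓ)) := by
    rw [← hσ, base_T, map_add, map_pow, map_pow]
  have hgen (b : SurfaceRing p q 1) : ∃ h : Polynomial (Polynomial ℂ[T;T⁻¹]), h.degree < p ∧
      evalPair ((base one_ne_zero).toRingHom.comp σ.toRingHom) (e x) (e y) h = b := by
    obtain ⟨h, hdeg, hh⟩ := exists_evalPair_eq hp0 hℓ (e.symm b)
    refine ⟨h, hdeg, ?_⟩
    have hcomp : (base one_ne_zero).toRingHom.comp σ.toRingHom =
        (e : SurfaceRing p q ℓ →+* SurfaceRing p q 1).comp (base hℓ).toRingHom :=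
      RingHom.ext fun r => (hσ r).symm
    rw [← e.apply_symm_apply b, ← hh, hcomp]
    exact (map_evalPair (e : SurfaceRing p q ℓ →+* SurfaceRing p q 1) _ x y h).symm
  have hz : σ (.T ℓ) ≠ 0 := ((LaurentPolynomial.isUnit_T _).map σ).ne_zero
  obtain ⟨hX, hY⟩ := valuation_of_generating hp0 hq0 hpq one_ne_zero hv hx hy (σ := σ.toRingHom)
    hσinj hgen hz hrel
  obtain ⟨α, β, γ, g, hα, hX', hY'⟩ :=
    exists_eq_of_valuation hp hlt hpq one_ne_zero hv hx hy hX hY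
  rw [← hX', ← hY'] at hrel
  obtain ⟨h₁, h₂⟩ := exists_pow_mul_eq hp hlt hpq one_ne_zero hα hrel
  obtain ⟨c, hc, h₃⟩ := hk ℓ
  rw [h₃, Nat.cast_one] at h₁ h₂
  have hdvd : ((p * q : ℕ) : ℤ) ∣ k * ℓ - 1 := by
    rw [Nat.cast_mul]
    exact (Nat.isCoprime_iff_coprime.2 hpq).mul_dvd (dvd_of_pow_mul_T hc hp0 h₁)
      (dvd_of_pow_mul_T hc hq0 h₂)
  obtain ⟨rfl, -⟩ | ⟨rfl, -⟩ := Int.mul_eq_one_iff_eq_one_or_neg_one.1 hkk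
  · left; simpa using hdvd
  · right
    rw [← dvd_neg]
    convert! hdvd using 1
    ring

/-- An isomorphism of the surfaces forces `ℓ ≡ ±1` modulo `p * q`. -/
theorem dvd_of_algEquiv (hp : 2 ≤ p) (hq : 2 ≤ q) (hpq : p.Coprime q) (hℓ : ℓ ≠ 0)
    (e : SurfaceRing p q ℓ ≃ₐ[ℂ] SurfaceRing p q 1) :
    ((p * q : ℕ) : ℤ) ∣ ℓ - 1 ∨ ((p * q : ℕ) : ℤ) ∣ ℓ + 1 := by
  rcases lt_trichotomy p q with h | rfl | h
  · exact dvd_of_algEquiv_of_lt hp h hpq hℓ e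
  · rw [Nat.coprime_self] at hpq
    lia
  · rw [mul_comm]
    exact dvd_of_algEquiv_of_lt hq h hpq.symm hℓ (((swap q p ℓ).trans e).trans (swap p q 1))

end SurfaceRing

theorem mainTheorem1 (p q ℓ : ℕ) (hp : p.Prime) (hq : 3 ≤ q) (hpq : q.Coprime p)
    (hℓ : 2 ≤ ℓ) (hℓm : ℓ.Coprime (p * q)) :
    IsSmoothFactorialAffineSurface (surface p q 1) ∧
    IsSmoothFactorialAffineSurface (surface p q ℓ) ∧
    Nonempty (cylinder (surface p q 1) ≅ cylinder (surface p q ℓ)) ∧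
    (¬ (ℓ : ℤ) ≡ 1 [ZMOD (p * q : ℕ)] → ¬ (ℓ : ℤ) ≡ -1 [ZMOD (p * q : ℕ)] →
      ¬ Nonempty (surface p q 1 ≅ surface p q ℓ)) := by
  have hm : 1 < p * q := by nlinarith [hp.two_le]
  refine ⟨?_, ?_, ?_, ?_⟩
  · obtain ⟨h₁, h₂⟩ := SurfaceRing.isDomain_and_uniqueFactorizationMonoid_one (p := p) (q := q)
    have := SurfaceRing.isStandardSmoothOfRelativeDimension (p := p) (q := q) one_ne_zero
    exact .of_isStandardSmooth _
  · obtain ⟨h₁, h₂⟩ := SurfaceRing.isDomain_and_uniqueFactorizationMonoid hℓ hm hℓm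
    have := SurfaceRing.isStandardSmoothOfRelativeDimension (p := p) (q := q) (ℓ := ℓ) (by lia)
    exact .of_isStandardSmooth _
  · obtain ⟨e⟩ := SurfaceRing.nonempty_cylinder_algEquiv hℓ hm hℓm
    exact ⟨SpecC.cylinderIso _ ≪≫ SpecC.isoOfAlgEquiv e.symm ≪≫ (SpecC.cylinderIso _).symm⟩
  · rintro h₁ h₂ ⟨e⟩
    obtain ⟨f⟩ := nonempty_algEquiv_of_specC_iso e.symm
    rcases SurfaceRing.dvd_of_algEquiv hp.two_le (by lia) hpq.symm (by lia) f with h | h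
    · exact h₁ (Int.modEq_iff_dvd.2 h).symm
    · refine h₂ (Int.modEq_iff_dvd.2 ?_).symm
      rwa [sub_neg_eq_add]
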